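/- **Theorem 1.3.** Let $G$ be a group generated by a finite set $A$, and let $B_n=(A\cup A^{-1}\cup\{1_G\})^n$, $n\ge 0$, be the balls of the associated word length. A sequence $(F_i)$ of finite subsets of $G$ is called *Besicovitch* if there is a constant $C$ such that for every finite $S\subseteq G$ and every choice of indices $(k(g))_{g\in S}$ there is $S'\subseteq S$ with $$1_S(h)\;\le\;\sum_{g\in S'}1_{F_{k(g)}g}(h)\;\le\; C\qquad\text{for all }h\in G .$$ The *ratio ergodic theorem holds along* $(F_i)$ if for every ergodic measure-preserving action of $G$ on a non-atomic, $\sigma$-finite, infinite measure space $(X,\mathcal B,\mu)$, and all $\varphi,\psi\in L^1(\mu)$ with $\int\psi\,d\mu\ne 0$, $$\frac{\sum_{g\in F_i}\varphi(g x)}{\sum_{g\in F_i}\psi(g x)}\;\longrightarrow\;\frac{\int\varphi\,d\mu}{\int\psi\,d\mu}\qquad\text{as }i\to\infty,\ \text{for }\mu\text{-a.e. }x ;$$ otherwise it *fails along* $(F_i)$. Suppose that for every strictly increasing sequence $m(1)<m(2)<\cdots$ of natural numbers the sequence $(B_{m(i)})_i$ is not Besicovitch. Then for every strictly increasing sequence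 $n(1)<n(2)<\cdots$ the ratio ergodic theorem fails along $F_i=B_{n(i)}$. -/

import Mathlib

open MeasureTheory Filter Topology
open scoped Pointwise

namespace RatioErgodic

/-! ### Balls and the Besicovitch covering property -/

open Classical in
/-- The ball of radius `n` about the identity for the word length defined by the finite set `A`:
the products of at most `n` factors, each of them in `A` or in `A⁻¹`. -/
noncomputable def wordBall {G : Type*} [Group G] (A : Finset G) (n : ℕ) : Finset G :=
  (insert 1 (A ∪ A⁻¹)) ^ n

open Classical in
/-- The (right) Besicovitch covering property of a sequence of finite sets: there is a constant
`C` such that from every finite family of right translates `{F (n g) * g}`, `g ∈ A`, one can choose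
a subfamily, indexed by `A' ⊆ A`, that covers `A` and has multiplicity at most `C`. Here
`h * g⁻¹ ∈ F (n g)` says that `h` belongs to the translate `F (n g) * g`. -/
def IsBesicovitch {G : Type*} [Group G] (F : ℕ → Finset G) : Prop :=
  ∃ C : ℕ, ∀ (A : Finset G) (n : G → ℕ), ∃ A' : Finset G, A' ⊆ A ∧
    (∀ h ∈ A, ∃ g ∈ A', h * g⁻¹ ∈ F (n g)) ∧
    ∀ h : G, (A'.filter fun g => h * g⁻¹ ∈ F (n g)).card ≤ C

/-! ### The ratio ergodic theorem -/

/-- A measure is non-atomic if every measurable set of positive measure has a measurable subset of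
positive and strictly smaller measure. (On a general measurable space this is stronger than
`NoAtoms`, which only asks singletons to be null.) -/
def IsNonatomic {X : Type*} [MeasurableSpace X] (μ : Measure X) : Prop :=
  ∀ s : Set X, MeasurableSet s → 0 < μ s → ∃ t ⊆ s, MeasurableSet t ∧ 0 < μ t ∧ μ t < μ s

/-- The sum `S_F(φ)(x) = ∑_{g ∈ F} φ(g • x)`. -/
def orbitSum {G X : Type*} [SMul G X] (F : Finset G) (φ : X → ℝ) (x : X) : ℝ :=
  ∑ g ∈ F, φ (g • x)

/-- The ratio `R_F(φ, ψ)(x) = S_F(φ)(x) / S_F(ψ)(x)`. -/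
noncomputable def orbitRatio {G X : Type*} [SMul G X] (F : Finset G) (φ ψ : X → ℝ) (x : X) : ℝ :=
  orbitSum F φ x / orbitSum F ψ x

/-- The ratio ergodic theorem holds along `F`: for every ergodic measure-preserving (left) action
of `G` on a non-atomic `σ`-finite infinite measure space and all integrable `φ`, `ψ` with
`∫ ψ ≠ 0`, the ratios `R_{F n}(φ, ψ)` converge almost everywhere to `∫ φ / ∫ ψ`.
(`ErgodicSMul` includes that the measure is invariant.) -/
def RatioErgodicTheorem (G : Type*) [Group G] (F : ℕ → Finset G) : Prop :=
  ∀ (X : Type) [MeasurableSpace X] [MulAction G X] [MeasurableConstSMul G X]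
    (μ : Measure X) [SigmaFinite μ],
    ErgodicSMul G X μ → IsNonatomic μ → μ Set.univ = ⊤ →
    ∀ φ ψ : X → ℝ, Integrable φ μ → Integrable ψ μ → ∫ x, ψ x ∂μ ≠ 0 →
      ∀ᵐ x ∂μ, Tendsto (fun n => orbitRatio (F n) φ ψ x) atTop
        (𝓝 ((∫ x, φ x ∂μ) / ∫ x, ψ x ∂μ))

end RatioErgodic

/-!
Suppose that no subsequence of the sequence of balls, or of the balls with all radii enlarged by a
constant, is Besicovitch. Selecting balls greedily in the order of decreasing radii shows that there
are then arbitrarily many elements `c` of the group, each within its own radius of the identity,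
such that no `c'` is within the radius of another `c`, with room to replace each `c` by a copy
`D * c` of a given finite set `D` (`HasSpreadCenters`, `hasSpreadCenters_wordBall`). The balls
about the points of the copies then all reach a finite set `H`, which depends on `D` but not on the
number of copies, while none of them meets a copy other than that of its center.

Such configurations are the stages of a rank-one cutting-and-stacking construction
(`RankOneSystem`, `HasSpreadCenters.exists_system`): a tower of shape `F m` is put at the positions
`C m` into a tower of shape `F (m + 1)`, which is taken so large that the measure is infinite and
that every group element eventually acts inside of the towers. This works for every countable
infinite group. The space is realized as the set of germs at infinity of sequences in the group, on
which the group acts by left multiplication (`TailSpace`). A point of the tower of stage `m` at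
position `f` is the germ of the sequence `n ↦ f * ω m * ⋯ * ω (n - 1)`, where `ω i ∈ C i`, and the
measure is the increasing limit of multiples of the laws of these germs for independent uniform
`ω i`. Invariance comes from the absorption of translates by later towers, ergodicity from
Kolmogorov's zero-one law (`law_eq_zero_or_one`).

Let `ψ` be the indicator of the base level, which is the tower of stage `0`, and let `φ` put on each
of the levels `H m` the mass that `ψ` has in a single copy of the tower of stage `m`. As `H m` is
hit once for the `|C m|` copies, `φ` has integral at most `∑ |H m| / |C m| ≤ 1 / 2`. From every
point of the base level the ball for its copy at stage `m` sees at least that mass of `φ`, and of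
`ψ` only what is in one copy. So the ratio is at least `1` at arbitrarily late times, whereas it
should tend to a limit `≤ 1 / 2`.
-/

namespace RatioErgodic

open ProbabilityTheory
open scoped ENNReal

/-! ### Germs at infinity of sequences in a group -/

theorem iSup_comap_eval_le {G : Type*} [MeasurableSpace G] (S : Set ℕ) :
    (⨆ i ∈ S, MeasurableSpace.comap (fun ω : ℕ → G => ω i) inferInstance) ≤
      (inferInstance : MeasurableSpace (ℕ → G)) :=
  iSup₂_le fun i _ => (measurable_pi_apply i).comap_le

section Space

variable {G : Type*} [Countable G]

/-- The germs at infinity of sequences in `G`. A copy of `G` in `Type` is used for the values, so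
that the space is in `Type` whatever the universe of `G` is. -/
def TailSpace (G : Type*) [Countable G] : Type := Germ (atTop : Filter ℕ) (Shrink.{0} G)

/-- The class of a sequence in the space of germs at infinity. -/
noncomputable def toTail (a : ℕ → G) : TailSpace G :=
  ((fun n => equivShrink.{0} G (a n) : ℕ → Shrink.{0} G) : Germ atTop (Shrink.{0} G))

theorem toTail_eq_iff {a b : ℕ → G} : toTail a = toTail b ↔ ∀ᶠ n in atTop, a n = b n := by
  unfold toTail
  refine Germ.coe_eq.trans ?_
  simp only [EventuallyEq, EmbeddingLike.apply_eq_iff_eq]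

/-- The quotient `σ`-algebra: a set of germs is measurable if the set of sequences that
represent its elements is measurable. -/
noncomputable instance [MeasurableSpace G] : MeasurableSpace (TailSpace G) :=
  MeasurableSpace.map toTail inferInstance

theorem measurableSet_tail_iff [MeasurableSpace G] {s : Set (TailSpace G)} :
    MeasurableSet s ↔ MeasurableSet (toTail ⁻¹' s : Set (ℕ → G)) := Iff.rfl

theorem measurable_toTail [MeasurableSpace G] :
    Measurable (toTail : (ℕ → G) → TailSpace G) := fun _ h => h

/-- `G` acts on germs of sequences by left multiplication of all terms. -/
noncomputable instance [Group G] : MulAction G (TailSpace G) :=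
  inferInstanceAs (MulAction G (Germ (atTop : Filter ℕ) (Shrink.{0} G)))

theorem smul_toTail [Group G] (g : G) (a : ℕ → G) :
    g • toTail a = toTail (fun n => g * a n) := by
  have : ∀ n, equivShrink.{0} G (g * a n) = g • equivShrink.{0} G (a n) := by
    intro n
    rw [← smul_eq_mul, equivShrink_smul]
  unfold toTail
  simp only [this]
  rfl

instance [Group G] [MeasurableSpace G] [DiscreteMeasurableSpace G] :
    MeasurableConstSMul G (TailSpace G) where
  measurable_const_smul g := by
    intro s hs
    rw [measurableSet_tail_iff] at hs ⊢
    have : Measurable (fun (a : ℕ → G) (n : ℕ) => g * a n) :=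
      measurable_pi_lambda _ fun n => (Measurable.of_discrete).comp (measurable_pi_apply n)
    convert this hs using 1
    ext a
    simp [smul_toTail]

end Space

/-! ### Paths with prescribed steps -/

section Walk

variable {G : Type*} [Group G]

/-- The path that rests at `f` up to time `m` and then follows the steps `ω m, ω (m + 1), …` by
right multiplication: its value at time `n ≥ m` is `f * ω m * ⋯ * ω (n - 1)`. The steps before time
`m` are ignored, so that one space of step sequences serves all starting times. -/
def walk (f : G) (m : ℕ) (ω : ℕ → G) : ℕ → G
  | 0 => f
  | n + 1 => if n < m then f else walk f m ω n * ω n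

theorem walk_of_le (f : G) (m : ℕ) (ω : ℕ → G) {n : ℕ} (h : n ≤ m) : walk f m ω n = f := by
  cases n with
  | zero => rfl
  | succ n => simp [walk, Nat.lt_of_succ_le h]

theorem walk_succ (f : G) {m : ℕ} (ω : ℕ → G) {n : ℕ} (h : m ≤ n) :
    walk f m ω (n + 1) = walk f m ω n * ω n := by
  simp [walk, not_lt.2 h]

theorem mul_walk (g f : G) (m : ℕ) (ω : ℕ → G) (n : ℕ) :
    g * walk f m ω n = walk (g * f) m ω n := by
  induction n with
  | zero => rfl
  | succ n ih =>
    rcases lt_or_ge n m with h | h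
    · simp [walk_of_le _ _ _ (Nat.succ_le_of_lt h)]
    · rw [walk_succ _ _ h, walk_succ _ _ h, ← ih, mul_assoc]

theorem walk_eq_walk (f : G) {m k : ℕ} (ω : ℕ → G) (hk : m ≤ k) {n : ℕ} (h : k ≤ n) :
    walk f m ω n = walk (walk f m ω k) k ω n := by
  induction n, h using Nat.le_induction with
  | base => rw [walk_of_le _ _ _ le_rfl]
  | succ n hn ih => rw [walk_succ _ _ hn, walk_succ _ _ (hk.trans hn), ih]

variable [Countable G]

/-- The point of the space of germs that the path from `f` at time `m` with steps `ω` determines. -/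
noncomputable def walkEnd (f : G) (m : ℕ) (ω : ℕ → G) : TailSpace G := toTail (walk f m ω)

theorem walkEnd_eq (f : G) {m k : ℕ} (hk : m ≤ k) (ω : ℕ → G) :
    walkEnd f m ω = walkEnd (walk f m ω k) k ω :=
  toTail_eq_iff.2 <| (eventually_ge_atTop k).mono fun _ h => walk_eq_walk f ω hk h

theorem walkEnd_succ (f : G) (m : ℕ) (ω : ℕ → G) :
    walkEnd f m ω = walkEnd (f * ω m) (m + 1) ω := by
  rw [walkEnd_eq f m.le_succ, walk_succ _ _ le_rfl, walk_of_le _ _ _ le_rfl]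

theorem smul_walkEnd (g f : G) (m : ℕ) (ω : ℕ → G) :
    g • walkEnd f m ω = walkEnd (g * f) m ω := by
  rw [walkEnd, smul_toTail]
  simp only [mul_walk]
  rfl

variable [MeasurableSpace G] [DiscreteMeasurableSpace G]

/-- The path from time `m` on depends measurably on the steps from time `m` on. The smaller
`σ`-algebra is what independence and the zero-one law need. -/
theorem measurable_walk_iSup (f : G) (m : ℕ) :
    Measurable[⨆ i ∈ Set.Ici m, MeasurableSpace.comap (fun ω : ℕ → G => ω i) inferInstance]
      (walk f m) := by
  refine @measurable_pi_lambda _ _ _ (_) _ _ fun n => ?_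
  induction n with
  | zero => exact @measurable_const _ _ _ (_) f
  | succ n ih =>
    rcases lt_or_ge n m with h | h
    · simp only [walk_of_le f m _ (Nat.succ_le_of_lt h)]
      exact @measurable_const _ _ _ (_) f
    · simp only [walk_succ f _ h]
      have h2 : Measurable[⨆ i ∈ Set.Ici m,
          MeasurableSpace.comap (fun ω : ℕ → G => ω i) inferInstance] (fun ω : ℕ → G => ω n) :=
        Measurable.mono (comap_measurable _)
          (le_iSup₂_of_le (f := fun i (_ : i ∈ Set.Ici m) =>
            MeasurableSpace.comap (fun ω : ℕ → G => ω i) inferInstance) n h le_rfl) le_rfl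
      exact @Measurable.mul _ _ _ _ _ (_) _ _ ih h2

theorem measurable_walkEnd (f : G) (m : ℕ) :
    Measurable (walkEnd f m : (ℕ → G) → TailSpace G) :=
  measurable_toTail.comp ((measurable_walk_iSup f m).mono (iSup_comap_eval_le _) le_rfl)

end Walk

/-! ### Increasing limits of measures -/

section Limit

variable {X : Type*} [MeasurableSpace X]

/-- The increasing limit of a sequence of measures, written as the sum of its increments. -/
noncomputable def limitMeasure (ν : ℕ → Measure X) : Measure X :=
  ν 0 + Measure.sum fun n => ν (n + 1) - ν n

theorem limitMeasure_apply {ν : ℕ → Measure X} [∀ n, IsFiniteMeasure (ν n)] (hν : Monotone ν)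
    {s : Set X} (hs : MeasurableSet s) : limitMeasure ν s = ⨆ n, ν n s := by
  have key : ∀ n, ν 0 s + ∑ i ∈ Finset.range n, (ν (i + 1) - ν i) s = ν n s := by
    intro n
    induction n with
    | zero => simp
    | succ n ih =>
      rw [Finset.sum_range_succ, ← add_assoc, ih, add_comm, ← Measure.add_apply,
        Measure.sub_add_cancel_of_le (hν n.le_succ)]
  rw [limitMeasure, Measure.add_apply, Measure.sum_apply _ hs, ENNReal.tsum_eq_iSup_nat,
    ENNReal.add_iSup]
  simp only [key]

end Limit

/-! ### Rank-one systems and their measures -/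

/-- The data of a rank-one cutting-and-stacking construction over a group. The tower of stage `m`
has levels indexed by `F m`, and the tower of stage `m + 1` contains the disjoint translates
`F m * c`, for `c ∈ C m`, as copies of it. Nothing like a Følner condition is needed because the
measure may be infinite: `F (m + 1)` may be as large as one likes compared to `F m * C m`. -/
structure RankOneSystem (G : Type*) [Group G] where
  /-- The shapes of the towers. -/
  F : ℕ → Finset G
  /-- The positions of the copies of each tower in the next one. -/
  C : ℕ → Finset G
  F_zero : F 0 = {1}
  /-- There are at least two copies, so that the levels shrink and the measure has no atoms. -/
  two_le : ∀ m, 2 ≤ (C m).card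
  /-- The copies are disjoint. -/
  inj : ∀ m, ∀ f ∈ F m, ∀ f' ∈ F m, ∀ c ∈ C m, ∀ c' ∈ C m, f * c = f' * c' → c = c'
  mul_mem : ∀ m, ∀ f ∈ F m, ∀ c ∈ C m, f * c ∈ F (m + 1)
  /-- Every group element eventually moves the copies of a tower within the next tower; this makes
  the limit measure invariant. -/
  absorb : ∀ g : G, ∀ᶠ m in atTop, ∀ f ∈ F m, ∀ c ∈ C m, g * (f * c) ∈ F (m + 1)
  /-- At least half of each tower is new, so that the total measure is infinite. -/
  growth : ∀ m, 2 * ((F m).card * (C m).card) ≤ (F (m + 1)).card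

namespace RankOneSystem

variable {G : Type*} [Group G] (S : RankOneSystem G)

theorem injOn_mul (m : ℕ) :
    Set.InjOn (fun p : G × G => p.1 * p.2) (S.F m ×ˢ S.C m : Finset _) := by
  rintro ⟨f, c⟩ h ⟨f', c'⟩ h' heq
  simp only [Finset.coe_product, Set.mem_prod, Finset.mem_coe] at h h' heq
  have := S.inj m f h.1 f' h'.1 c h.2 c' h'.2 heq
  subst this
  simpa using heq

theorem card_ne_zero (m : ℕ) : ((S.C m).card : ℝ≥0∞) ≠ 0 := by
  have := S.two_le m
  exact_mod_cast (by omega : (S.C m).card ≠ 0)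

/-- The measure of a level of the tower of stage `m`. -/
noncomputable def weight (m : ℕ) : ℝ≥0∞ := ∏ i ∈ Finset.range m, ((S.C i).card : ℝ≥0∞)⁻¹

theorem weight_zero : S.weight 0 = 1 := by simp [weight]

theorem weight_succ (m : ℕ) : S.weight (m + 1) = S.weight m * ((S.C m).card : ℝ≥0∞)⁻¹ := by
  simp [weight, Finset.prod_range_succ]

theorem weight_ne_top (m : ℕ) : S.weight m ≠ ∞ := by
  induction m with
  | zero => simp [weight]
  | succ m ih =>
    rw [weight_succ]
    exact ENNReal.mul_ne_top ih (ENNReal.inv_ne_top.2 (S.card_ne_zero m))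

theorem weight_le (m : ℕ) : S.weight m ≤ 2⁻¹ ^ m := by
  induction m with
  | zero => simp [weight]
  | succ m ih =>
    rw [weight_succ, pow_succ]
    gcongr
    exact_mod_cast S.two_le m

theorem weight_mul_card (m : ℕ) : S.weight (m + 1) * (S.C m).card = S.weight m := by
  rw [weight_succ, mul_assoc, ENNReal.inv_mul_cancel (S.card_ne_zero m) (by simp), mul_one]

theorem two_pow_le (m : ℕ) : 2 ^ m ≤ S.weight m * (S.F m).card := by
  induction m with
  | zero => simp [weight, S.F_zero]
  | succ m ih =>
    calc (2 : ℝ≥0∞) ^ (m + 1) = 2 * 2 ^ m := pow_succ' _ _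
      _ ≤ 2 * (S.weight m * (S.F m).card) := by gcongr
      _ = S.weight (m + 1) * (2 * ((S.F m).card * (S.C m).card) : ℕ) := by
        rw [← S.weight_mul_card m]; push_cast; ring
      _ ≤ _ := by gcongr; exact S.growth m

/-- The uniform distribution on `C m`. -/
noncomputable def stepMeasure [MeasurableSpace G] (m : ℕ) : Measure G :=
  ((S.C m).card : ℝ≥0∞)⁻¹ • ∑ c ∈ S.C m, Measure.dirac c

instance [MeasurableSpace G] (m : ℕ) : IsProbabilityMeasure (S.stepMeasure m) := by
  constructor
  simp [stepMeasure, Measure.finsetSum_apply,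
    ENNReal.inv_mul_cancel (S.card_ne_zero m) (ENNReal.natCast_ne_top _)]

/-- The law of a sequence of independent steps, the `m`-th one uniform on `C m`. -/
noncomputable def prob [MeasurableSpace G] : Measure (ℕ → G) :=
  Measure.infinitePi S.stepMeasure

instance [MeasurableSpace G] : IsProbabilityMeasure S.prob := by
  unfold prob; infer_instance

variable [MeasurableSpace G]

theorem iIndep_eval :
    iIndep (fun i => MeasurableSpace.comap (fun ω : ℕ → G => ω i) inferInstance) S.prob :=
  iIndepFun_infinitePi (P := S.stepMeasure) (X := fun _ g => g) (fun _ => measurable_id)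

/-- The law of the germ of the random path that starts from `f` at time `m`. -/
noncomputable def law [Countable G] (f : G) (m : ℕ) : Measure (TailSpace G) :=
  S.prob.map (walkEnd f m)

/-- The `m`-th approximation to the measure: the restriction of the measure to the tower of
stage `m`. -/
noncomputable def approx [Countable G] (m : ℕ) : Measure (TailSpace G) :=
  S.weight m • ∑ f ∈ S.F m, S.law f m

theorem approx_apply [Countable G] (m : ℕ) (s : Set (TailSpace G)) :
    S.approx m s = S.weight m * ∑ f ∈ S.F m, S.law f m s := by
  simp [approx, Measure.finsetSum_apply]

variable [DiscreteMeasurableSpace G]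

theorem prob_eval (m : ℕ) (s : Set G) : S.prob {ω | ω m ∈ s} = S.stepMeasure m s := by
  rw [← Measure.infinitePi_map_eval S.stepMeasure m,
    Measure.map_apply (measurable_pi_apply m) (MeasurableSet.of_discrete)]
  rfl

theorem ae_mem : ∀ᵐ ω ∂S.prob, ∀ i, ω i ∈ S.C i := by
  rw [ae_all_iff]
  intro i
  change S.prob {ω | ω i ∈ (↑(S.C i) : Set G)ᶜ} = 0
  rw [prob_eval]
  simp only [stepMeasure, Measure.smul_apply, Measure.finsetSum_apply, smul_eq_mul, mul_eq_zero]
  right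
  refine Finset.sum_eq_zero fun c hc => ?_
  rw [Measure.dirac_apply' _ MeasurableSet.of_discrete]
  simp [hc]

theorem prob_eval_singleton {m : ℕ} {c : G} (hc : c ∈ S.C m) :
    S.prob {ω | ω m = c} = ((S.C m).card : ℝ≥0∞)⁻¹ := by
  have := S.prob_eval m {c}
  simp only [Set.mem_singleton_iff] at this
  rw [this]
  simp only [stepMeasure, Measure.smul_apply, Measure.finsetSum_apply, smul_eq_mul]
  rw [Finset.sum_eq_single c]
  · simp
  · intro b _ hb
    rw [Measure.dirac_apply' _ MeasurableSet.of_discrete]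
    simp [hb]
  · exact fun h => absurd hc h

variable [Countable G]

instance (f : G) (m : ℕ) : IsProbabilityMeasure (S.law f m) :=
  Measure.isProbabilityMeasure_map (measurable_walkEnd f m).aemeasurable

theorem measurableSet_walkEnd (f : G) (m : ℕ) {s : Set (TailSpace G)} (hs : MeasurableSet s) :
    MeasurableSet[⨆ i ∈ Set.Ici m, MeasurableSpace.comap (fun ω : ℕ → G => ω i) inferInstance]
      (walkEnd f m ⁻¹' s) :=
  measurable_walk_iSup f m (measurableSet_tail_iff.1 hs)

/-- Conditioning on the first step of the random path. -/
theorem law_succ (f : G) (m : ℕ) :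
    S.law f m = ((S.C m).card : ℝ≥0∞)⁻¹ • ∑ c ∈ S.C m, S.law (f * c) (m + 1) := by
  ext s hs
  simp only [law, Measure.smul_apply, Measure.finsetSum_apply, smul_eq_mul]
  rw [Measure.map_apply (measurable_walkEnd _ _) hs]
  have hE : ∀ c : G, MeasurableSet {ω : ℕ → G | ω m = c} := fun c =>
    measurable_pi_apply (X := fun _ : ℕ => G) m (MeasurableSet.of_discrete (s := {c}))
  have hW : ∀ c, MeasurableSet (walkEnd (f * c) (m + 1) ⁻¹' s : Set (ℕ → G)) := fun c =>
    measurable_walkEnd _ _ hs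
  have h1 : (walkEnd f m ⁻¹' s : Set (ℕ → G)) =ᵐ[S.prob]
      ⋃ c ∈ S.C m, {ω : ℕ → G | ω m = c} ∩ walkEnd (f * c) (m + 1) ⁻¹' s := by
    filter_upwards [S.ae_mem] with ω hω
    apply propext
    change walkEnd f m ω ∈ s ↔ ω ∈ ⋃ c ∈ S.C m, _
    simp only [Set.mem_iUnion, Set.mem_inter_iff, Set.mem_ofPred_eq, Set.mem_preimage]
    rw [walkEnd_succ]
    constructor
    · exact fun h => ⟨ω m, hω m, rfl, h⟩
    · rintro ⟨c, _, rfl, h⟩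
      exact h
  rw [measure_congr h1, measure_biUnion_finset, Finset.mul_sum]
  · refine Finset.sum_congr rfl fun c hc => ?_
    rw [Measure.map_apply (measurable_walkEnd _ _) hs, ← S.prob_eval_singleton hc]
    have hind := indep_iSup_of_disjoint (fun i => (measurable_pi_apply i).comap_le) S.iIndep_eval
      (S := {m}) (T := Set.Ici (m + 1)) (by simp)
    rw [Indep_iff] at hind
    refine hind _ _ ?_ (measurableSet_walkEnd _ _ hs)
    rw [iSup_singleton]
    exact ⟨{c}, MeasurableSet.of_discrete, rfl⟩
  · intro c _ c' _ hcc'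
    refine Set.disjoint_left.2 fun ω h h' => hcc' ?_
    exact h.1.symm.trans h'.1
  · exact fun c _ => (hE c).inter (hW c)

instance (m : ℕ) : IsFiniteMeasure (S.approx m) := by
  constructor
  rw [approx_apply]
  exact ENNReal.mul_lt_top (S.weight_ne_top m).lt_top
    (ENNReal.sum_lt_top.2 fun f _ => measure_lt_top _ _)

/-- The `m`-th approximation is the part over `F m * C m` of the next one. -/
theorem approx_eq (m : ℕ) (s : Set (TailSpace G)) :
    S.approx m s = S.weight (m + 1) *
      ∑ p ∈ S.F m ×ˢ S.C m, S.law (p.1 * p.2) (m + 1) s := by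
  rw [approx_apply, weight_succ, Finset.sum_product, mul_assoc, Finset.mul_sum _ _ (_⁻¹)]
  congr 1
  refine Finset.sum_congr rfl fun f _ => ?_
  rw [S.law_succ f m]
  simp [Measure.finsetSum_apply]

/-- If `g * (F m * C m)` is contained in `F (m + 1)`, then `g` maps the `m`-th approximation
into the next one. -/
theorem approx_preimage_smul_le (g : G) (m : ℕ)
    (h : ∀ f ∈ S.F m, ∀ c ∈ S.C m, g * (f * c) ∈ S.F (m + 1)) {s : Set (TailSpace G)}
    (hs : MeasurableSet s) : S.approx m ((g • ·) ⁻¹' s) ≤ S.approx (m + 1) s := by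
  rw [approx_eq, approx_apply]
  gcongr
  have : ∀ p : G × G, S.law (p.1 * p.2) (m + 1) ((g • ·) ⁻¹' s) =
      S.law (g * (p.1 * p.2)) (m + 1) s := by
    intro p
    rw [law, law, Measure.map_apply (measurable_walkEnd _ _) hs,
      Measure.map_apply (measurable_walkEnd _ _) (measurable_const_smul g hs)]
    congr 1
    ext ω
    simp [smul_walkEnd]
  simp only [this]
  classical
  rw [← Finset.sum_image (f := fun x => S.law x (m + 1) s) (g := fun p : G × G => g * (p.1 * p.2))
    (s := S.F m ×ˢ S.C m)]
  · refine Finset.sum_le_sum_of_subset ?_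
    intro x hx
    obtain ⟨p, hp, rfl⟩ := Finset.mem_image.1 hx
    rw [Finset.mem_product] at hp
    exact h _ hp.1 _ hp.2
  · intro p hp q hq hpq
    exact S.injOn_mul m hp hq (mul_left_cancel hpq)

theorem approx_mono : Monotone S.approx := by
  refine monotone_nat_of_le_succ fun m => Measure.le_intro fun s hs _ => ?_
  simpa using S.approx_preimage_smul_le 1 m (by simpa using S.mul_mem m) hs

/-- The invariant measure of a rank-one system, on the space of germs. -/
noncomputable def measure : Measure (TailSpace G) := limitMeasure S.approx

theorem measure_apply {s : Set (TailSpace G)} (hs : MeasurableSet s) :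
    S.measure s = ⨆ m, S.approx m s := limitMeasure_apply S.approx_mono hs

theorem approx_le_measure (m : ℕ) : S.approx m ≤ S.measure :=
  Measure.le_intro fun s hs _ => by
    rw [S.measure_apply hs]
    exact le_iSup (fun m => S.approx m s) m

theorem measure_preimage_smul_le (g : G) {s : Set (TailSpace G)} (hs : MeasurableSet s) :
    S.measure ((g • ·) ⁻¹' s) ≤ S.measure s := by
  obtain ⟨M, hM⟩ := eventually_atTop.1 (S.absorb g)
  rw [S.measure_apply (measurable_const_smul g hs)]
  refine iSup_le fun m => ?_
  calc S.approx m ((g • ·) ⁻¹' s) ≤ S.approx (max m M) ((g • ·) ⁻¹' s) :=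
        S.approx_mono (le_max_left _ _) _
    _ ≤ S.approx (max m M + 1) s := S.approx_preimage_smul_le g _ (hM _ (le_max_right _ _)) hs
    _ ≤ S.measure s := S.approx_le_measure _ _

instance : SMulInvariantMeasure G (TailSpace G) S.measure where
  measure_preimage_smul g s hs := by
    refine le_antisymm (S.measure_preimage_smul_le g hs) ?_
    have := S.measure_preimage_smul_le g⁻¹ (measurable_const_smul g hs)
    rwa [← Set.preimage_comp, show ((g • ·) ∘ (g⁻¹ • ·) : TailSpace G → _) = id from
      funext fun x => by simp, Set.preimage_id] at this

theorem measure_univ : S.measure Set.univ = ∞ := by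
  have h : ∀ m : ℕ, (2 : ℝ≥0∞) ^ m ≤ S.measure Set.univ := by
    intro m
    refine le_trans ?_ (S.approx_le_measure m Set.univ)
    rw [approx_apply]
    simpa using S.two_pow_le m
  have h2 : Tendsto (fun m : ℕ => (2 : ℝ≥0∞) ^ m) atTop (𝓝 ∞) :=
    ENNReal.tendsto_pow_atTop_nhds_top_iff.2 (by norm_num)
  exact top_le_iff.1 (le_of_tendsto' h2 h)

/-- For an invariant set `s`, the event that the random path ends in `s` does not depend on the
starting point and hence not on finitely many of the steps either: it is a tail event, to which
Kolmogorov's zero-one law applies. -/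
theorem law_eq_zero_or_one {s : Set (TailSpace G)} (hs : MeasurableSet s)
    (hinv : ∀ (g : G) x, g • x ∈ s ↔ x ∈ s) :
    (∀ f m, S.law f m s = 0) ∨ (∀ f m, S.law f m s = 1) := by
  have hf : ∀ (f : G) (m : ℕ) (ω : ℕ → G), walkEnd f m ω ∈ s ↔ walkEnd 1 0 ω ∈ s := by
    intro f m ω
    rw [walkEnd_eq 1 (Nat.zero_le m), ← hinv (walk 1 0 ω m * f⁻¹), smul_walkEnd]
    simp
  have hlaw : ∀ f m, S.law f m s = S.prob (walkEnd 1 0 ⁻¹' s) := by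
    intro f m
    rw [law, Measure.map_apply (measurable_walkEnd _ _) hs]
    congr 1
    ext ω
    exact hf f m ω
  have := measure_zero_or_one_of_measurableSet_limsup_atTop
    (fun i => (measurable_pi_apply i).comap_le) S.iIndep_eval
    (t := (walkEnd 1 0 ⁻¹' s : Set (ℕ → G))) (by
      rw [limsup_eq_iInf_iSup_of_nat, MeasurableSpace.measurableSet_iInf]
      intro m
      have h1 : (walkEnd 1 0 ⁻¹' s : Set (ℕ → G)) = walkEnd 1 m ⁻¹' s := by
        ext ω
        exact (hf 1 m ω).symm
      rw [h1]
      exact measurableSet_walkEnd 1 m hs)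
  simpa only [hlaw, forall_const] using this

theorem measure_eq_zero_of_law {s : Set (TailSpace G)} (hs : MeasurableSet s)
    (h : ∀ m, ∀ f ∈ S.F m, S.law f m s = 0) : S.measure s = 0 := by
  rw [S.measure_apply hs, ENNReal.iSup_eq_zero]
  intro m
  rw [approx_apply, Finset.sum_eq_zero (h m), mul_zero]

instance : ErgodicSMul G (TailSpace G) S.measure where
  aeconst_of_forall_preimage_smul_ae_eq {s} hs h := by
    -- `s` is only almost invariant; the intersection of its countably many translates is
    -- strictly invariant and agrees with it almost everywhere.
    set t : Set (TailSpace G) := ⋂ g : G, (g • ·) ⁻¹' s with ht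
    have htm : MeasurableSet t := MeasurableSet.iInter fun g => measurable_const_smul g hs
    have hst : t =ᵐ[S.measure] s := by
      have : t =ᵐ[S.measure] ⋂ _ : G, s := Filter.EventuallyEq.countable_iInter h
      rwa [Set.iInter_const] at this
    have hinv : ∀ (g : G) x, g • x ∈ t ↔ x ∈ t := by
      intro g x
      simp only [ht, Set.mem_iInter, Set.mem_preimage, smul_smul]
      exact ⟨fun H k => by simpa using H (k * g⁻¹), fun H k => H _⟩
    refine EventuallyConst.congr ?_ hst
    rw [eventuallyConst_set']
    rcases S.law_eq_zero_or_one htm hinv with h0 | h1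
    · left
      exact ae_eq_empty.2 (S.measure_eq_zero_of_law htm fun m f _ => h0 f m)
    · right
      refine ae_eq_univ.2 (S.measure_eq_zero_of_law htm.compl fun m f _ => ?_)
      rw [prob_compl_eq_zero_iff htm, h1]

end RankOneSystem

/-! ### Levels of the towers -/

namespace RankOneSystem

variable {G : Type*} [Group G] (S : RankOneSystem G)

open Classical in
/-- The set `f * C n * ⋯ * C (k - 1)` of the positions in the tower of stage `k` into which the
level `f` of the tower of stage `n` is cut. For `k ≤ n` the value `{f}` is a convention. -/
noncomputable def branch (f : G) (n : ℕ) : ℕ → Finset G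
  | 0 => {f}
  | k + 1 => if k < n then {f} else branch f n k * S.C k

theorem branch_of_le (f : G) {n k : ℕ} (h : k ≤ n) : S.branch f n k = {f} := by
  cases k with
  | zero => rfl
  | succ k => simp [branch, Nat.lt_of_succ_le h]

theorem mem_branch_succ {f : G} {n k : ℕ} (h : n ≤ k) {g : G} :
    g ∈ S.branch f n (k + 1) ↔ ∃ e ∈ S.branch f n k, ∃ c ∈ S.C k, e * c = g := by
  simp [branch, not_lt.2 h, Finset.mem_mul]

theorem branch_subset {f : G} {n : ℕ} (hf : f ∈ S.F n) {k : ℕ} (h : n ≤ k) :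
    S.branch f n k ⊆ S.F k := by
  induction k, h using Nat.le_induction with
  | base => simpa [S.branch_of_le f le_rfl] using hf
  | succ k hk ih =>
    intro g hg
    obtain ⟨e, he, c, hc, rfl⟩ := (S.mem_branch_succ hk).1 hg
    exact S.mul_mem k e (ih he) c hc

theorem weight_mul_card_branch {f : G} {n : ℕ} (hf : f ∈ S.F n) {k : ℕ} (h : n ≤ k) :
    S.weight k * (S.branch f n k).card = S.weight n := by
  induction k, h using Nat.le_induction with
  | base => simp [S.branch_of_le f le_rfl]
  | succ k hk ih =>
    classical
    have h1 : S.branch f n (k + 1) = (S.branch f n k ×ˢ S.C k).image (fun p => p.1 * p.2) := by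
      ext g
      rw [S.mem_branch_succ hk]
      simp only [Finset.mem_image, Finset.mem_product, Prod.exists]
      grind
    rw [h1, Finset.card_image_of_injOn, Finset.card_product, ← ih, ← S.weight_mul_card k]
    · push_cast; ring
    · refine (S.injOn_mul k).mono ?_
      exact_mod_cast Finset.product_subset_product_left (S.branch_subset hf hk)

theorem walk_mem_branch {f : G} {n k : ℕ} (hk : n ≤ k) {g : G} (hg : g ∈ S.branch f n k)
    {ω : ℕ → G} (hω : ∀ i, ω i ∈ S.C i) {M : ℕ} (h : k ≤ M) : walk g k ω M ∈ S.branch f n M := by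
  induction M, h using Nat.le_induction with
  | base => rwa [walk_of_le _ _ _ le_rfl]
  | succ M hM ih =>
    rw [walk_succ _ _ hM, S.mem_branch_succ (hk.trans hM)]
    exact ⟨_, ih, _, hω M, rfl⟩

theorem walk_mem {k : ℕ} {g : G} (hg : g ∈ S.F k)
    {ω : ℕ → G} (hω : ∀ i, ω i ∈ S.C i) {M : ℕ} (h : k ≤ M) : walk g k ω M ∈ S.F M := by
  induction M, h using Nat.le_induction with
  | base => rwa [walk_of_le _ _ _ le_rfl]
  | succ M hM ih =>
    rw [walk_succ _ _ hM]
    exact S.mul_mem M _ ih _ (hω M)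

/-- Since the copies of a tower in the next one are disjoint, a path in the towers that ends up
over the level `f` has been over it all the time. -/
theorem mem_branch_of_walk_mem {f : G} {n k : ℕ} (hf : f ∈ S.F n) (hk : n ≤ k) {g : G}
    (hg : g ∈ S.F k) {ω : ℕ → G} (hω : ∀ i, ω i ∈ S.C i) {M : ℕ} (h : k ≤ M)
    (hmem : walk g k ω M ∈ S.branch f n M) : g ∈ S.branch f n k := by
  induction M, h using Nat.le_induction with
  | base => rwa [walk_of_le _ _ _ le_rfl] at hmem
  | succ M hM ih =>
    rw [walk_succ _ _ hM, S.mem_branch_succ (hk.trans hM)] at hmem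
    obtain ⟨e, he, c, hc, heq⟩ := hmem
    refine ih ?_
    have := S.inj M e (S.branch_subset hf (hk.trans hM) he) _ (S.walk_mem hg hω hM)
      c hc _ (hω M) heq
    subst this
    rwa [← mul_right_cancel heq]

variable [Countable G]

/-- The level of the tower of stage `n` at position `f`: the germs whose terms eventually lie over
`f`. -/
def level (f : G) (n : ℕ) : Set (TailSpace G) :=
  {x | ∃ a, toTail a = x ∧ ∀ᶠ k in atTop, a k ∈ S.branch f n k}

theorem toTail_mem_level {f : G} {n : ℕ} {a : ℕ → G} :
    toTail a ∈ S.level f n ↔ ∀ᶠ k in atTop, a k ∈ S.branch f n k := by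
  constructor
  · rintro ⟨b, hb, h⟩
    filter_upwards [h, toTail_eq_iff.1 hb] with k hk hk'
    rwa [← hk']
  · exact fun h => ⟨a, rfl, h⟩

theorem walkEnd_mem_level {f : G} {n k : ℕ} (hf : f ∈ S.F n) (hk : n ≤ k) {g : G}
    (hg : g ∈ S.F k) {ω : ℕ → G} (hω : ∀ i, ω i ∈ S.C i) :
    walkEnd g k ω ∈ S.level f n ↔ g ∈ S.branch f n k := by
  rw [walkEnd, toTail_mem_level]
  constructor
  · intro h
    obtain ⟨M, hM, hkM⟩ := (h.and (eventually_ge_atTop k)).exists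
    exact S.mem_branch_of_walk_mem hf hk hg hω hkM hM
  · exact fun h => (eventually_ge_atTop k).mono fun M hM => S.walk_mem_branch hk h hω hM

variable [MeasurableSpace G] [DiscreteMeasurableSpace G]

theorem measurableSet_level (f : G) (n : ℕ) : MeasurableSet (S.level f n) := by
  rw [measurableSet_tail_iff]
  have : toTail ⁻¹' S.level f n =
      ⋃ N, ⋂ k, ⋂ (_ : N ≤ k), {a : ℕ → G | a k ∈ (S.branch f n k : Set G)} := by
    ext a
    simp [toTail_mem_level, eventually_atTop]
  rw [this]
  exact MeasurableSet.iUnion fun N => MeasurableSet.iInter fun k => MeasurableSet.iInter fun _ =>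
    measurable_pi_apply (X := fun _ : ℕ => G) k MeasurableSet.of_discrete

theorem law_level {f : G} {n k : ℕ} (hf : f ∈ S.F n) (hk : n ≤ k) {g : G} (hg : g ∈ S.F k)
    [Decidable (g ∈ S.branch f n k)] :
    S.law g k (S.level f n) = if g ∈ S.branch f n k then 1 else 0 := by
  rw [law, Measure.map_apply (measurable_walkEnd _ _) (S.measurableSet_level f n)]
  split_ifs with h
  · rw [prob_compl_eq_zero_iff (measurable_walkEnd _ _ (S.measurableSet_level f n)) |>.symm]
    filter_upwards [S.ae_mem] with ω hω
    exact (S.walkEnd_mem_level hf hk hg hω).2 h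
  · refine measure_eq_zero_iff_ae_notMem.2 ?_
    filter_upwards [S.ae_mem] with ω hω
    exact fun h' => h ((S.walkEnd_mem_level hf hk hg hω).1 h')

theorem approx_level {f : G} {n k : ℕ} (hf : f ∈ S.F n) (hk : n ≤ k) :
    S.approx k (S.level f n) = S.weight n := by
  classical
  rw [approx_apply, Finset.sum_congr rfl fun g hg => S.law_level hf hk hg, Finset.sum_ite_mem,
    Finset.inter_eq_right.2 (S.branch_subset hf hk), Finset.sum_const, nsmul_one,
    S.weight_mul_card_branch hf hk]

theorem measure_level {f : G} {n : ℕ} (hf : f ∈ S.F n) :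
    S.measure (S.level f n) = S.weight n := by
  rw [S.measure_apply (S.measurableSet_level f n)]
  refine le_antisymm (iSup_le fun m => ?_) ?_
  · exact (S.approx_mono (le_max_left m n) _).trans (S.approx_level hf (le_max_right m n)).le
  · exact (S.approx_level hf le_rfl).ge.trans (le_iSup (fun m => S.approx m (S.level f n)) n)

/-- The levels of the towers beyond any given one cover the space up to a null set. -/
theorem measure_compl_iUnion_level (N : ℕ) :
    S.measure (⋃ n, ⋃ f ∈ S.F (N + n), S.level f (N + n))ᶜ = 0 := by
  have hm : MeasurableSet (⋃ n, ⋃ f ∈ S.F (N + n), S.level f (N + n)) :=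
    MeasurableSet.iUnion fun n => Finset.measurableSet_biUnion _ fun f _ =>
      S.measurableSet_level f _
  rw [S.measure_apply hm.compl, ENNReal.iSup_eq_zero]
  intro m
  refine le_antisymm ((S.approx_mono (Nat.le_add_left m N) _).trans ?_) zero_le
  rw [approx_apply, Finset.sum_eq_zero, mul_zero]
  intro f hf
  refine le_antisymm ?_ zero_le
  calc S.law f (N + m) (⋃ n, ⋃ f ∈ S.F (N + n), S.level f (N + n))ᶜ
      ≤ S.law f (N + m) (S.level f (N + m))ᶜ :=
        measure_mono (Set.compl_subset_compl.2 fun x hx =>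
          Set.mem_iUnion.2 ⟨m, Set.mem_iUnion₂.2 ⟨f, hf, hx⟩⟩)
    _ = 0 := by
        classical
        rw [prob_compl_eq_zero_iff (S.measurableSet_level f _), S.law_level hf le_rfl hf,
          if_pos (by simp [S.branch_of_le f le_rfl])]

instance : SigmaFinite S.measure := by
  set Z : Set (TailSpace G) := (⋃ n, ⋃ f ∈ S.F (0 + n), S.level f (0 + n))ᶜ with hZ
  refine ⟨⟨{ set := fun n => (⋃ f ∈ S.F (0 + n), S.level f (0 + n)) ∪ Z
             set_mem := fun _ => trivial
             finite := fun n => ?_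
             spanning := ?_ }⟩⟩
  · refine (measure_union_le _ _).trans_lt ?_
    rw [S.measure_compl_iUnion_level 0, add_zero]
    refine (measure_biUnion_finset_le _ _).trans_lt (ENNReal.sum_lt_top.2 fun f hf => ?_)
    rw [S.measure_level hf]
    exact (S.weight_ne_top _).lt_top
  · rw [← Set.iUnion_union, hZ, Set.union_compl_self]

theorem isNonatomic : IsNonatomic S.measure := by
  intro s hs hpos
  -- `s` meets some level of a late stage in positive measure, and that level has measure
  -- smaller than `s`.
  have hlim : Tendsto (fun n : ℕ => (2⁻¹ : ℝ≥0∞) ^ n) atTop (𝓝 0) :=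
    ENNReal.tendsto_pow_atTop_nhds_zero_of_lt_one (by norm_num)
  obtain ⟨N, hN⟩ := eventually_atTop.1 (hlim.eventually_lt_const hpos)
  obtain ⟨n, f, hf, hne⟩ : ∃ n, ∃ f ∈ S.F (N + n), S.measure (s ∩ S.level f (N + n)) ≠ 0 := by
    by_contra! h
    refine hpos.ne' (measure_mono_null (t := (⋃ n, ⋃ f ∈ S.F (N + n), s ∩ S.level f (N + n)) ∪
      (⋃ n, ⋃ f ∈ S.F (N + n), S.level f (N + n))ᶜ) ?_ ?_)
    · intro x hx
      by_cases hx' : x ∈ ⋃ n, ⋃ f ∈ S.F (N + n), S.level f (N + n)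
      · left
        simp only [Set.mem_iUnion] at hx' ⊢
        obtain ⟨n, f, hf, h⟩ := hx'
        exact ⟨n, f, hf, hx, h⟩
      · exact Or.inr hx'
    · refine measure_union_null (measure_iUnion_null fun n => ?_) (S.measure_compl_iUnion_level N)
      exact (measure_biUnion_null_iff (S.F (N + n)).countable_toSet).2 fun f hf => h n f hf
  refine ⟨s ∩ S.level f (N + n), Set.inter_subset_left, hs.inter (S.measurableSet_level _ _),
    pos_iff_ne_zero.2 hne, ?_⟩
  calc S.measure (s ∩ S.level f (N + n)) ≤ S.weight (N + n) :=
        (measure_mono Set.inter_subset_right).trans (S.measure_level hf).le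
    _ ≤ 2⁻¹ ^ (N + n) := S.weight_le _
    _ < S.measure s := hN _ (Nat.le_add_right _ _)

end RankOneSystem

/-! ### Systems adapted to spread centers -/

/-- A sequence of finite sets `B i` has spread centers if for every finite set `D` there is a finite
set `H` such that, for arbitrarily large finite sets `C` and arbitrarily late indices `r c`,
`c ∈ C`, the translates of `B (r c)` by the points of the copy `D * c` of `D` all meet `H`, and none of them
meets another copy `D * c'`. What matters is that `H` is chosen before the number of copies. -/
def HasSpreadCenters {G : Type*} [Group G] (B : ℕ → Finset G) : Prop :=
  ∀ D : Finset G, ∃ H : Finset G, ∀ N i₀ : ℕ, ∃ (C : Finset G) (r : G → ℕ), N ≤ C.card ∧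
    (∀ c ∈ C, i₀ ≤ r c) ∧ (∀ c ∈ C, ∀ f ∈ D, ∃ b ∈ B (r c), b * (f * c) ∈ H) ∧
    ∀ c ∈ C, ∀ f ∈ D, ∀ b ∈ B (r c), ∀ c' ∈ C, ∀ f' ∈ D, b * (f * c) = f' * c' → c = c'

section Construction

variable {G : Type*} [Group G]

theorem HasSpreadCenters.infinite {B : ℕ → Finset G} (hB : HasSpreadCenters B) : Infinite G := by
  obtain ⟨H, hH⟩ := hB ∅
  refine not_finite_iff_infinite.1 fun hfin => ?_
  have := Fintype.ofFinite G
  obtain ⟨C, _, hC, _⟩ := hH (Fintype.card G + 1) 0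
  have := C.card_le_univ
  omega

/-- One step of the construction: from the shape `F` of a tower, the positions `C` of its copies,
the set `H` that is reached from all of them, and the shape `F'` of the next tower. -/
theorem HasSpreadCenters.exists_next [Infinite G] {B : ℕ → Finset G} (hB : HasSpreadCenters B)
    (e : ℕ → G) (m : ℕ) (F : Finset G) :
    ∃ (C H F' : Finset G) (r : G → ℕ), 2 ≤ C.card ∧ H.card * 2 ^ (m + 2) ≤ C.card ∧
      (∀ c ∈ C, m ≤ r c) ∧ (∀ c ∈ C, ∀ f ∈ F, ∃ b ∈ B (r c), b * (f * c) ∈ H) ∧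
      (∀ c ∈ C, ∀ f ∈ F, ∀ b ∈ B (r c), ∀ c' ∈ C, ∀ f' ∈ F, b * (f * c) = f' * c' → c = c') ∧
      (∀ f ∈ F, ∀ c ∈ C, f * c ∈ F') ∧ (∀ i ≤ m, ∀ f ∈ F, ∀ c ∈ C, e i * (f * c) ∈ F') ∧
      H ⊆ F' ∧ (∀ c ∈ C, ∀ f ∈ F, ∀ b ∈ B (r c), b * (f * c) ∈ F') ∧
      2 * (F.card * C.card) ≤ F'.card := by
  classical
  obtain ⟨H, hH⟩ := hB F
  obtain ⟨C, r, hcard, hr, hmeet, hsep⟩ := hH (H.card * 2 ^ (m + 2) + 2) m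
  set T : Finset G := F * C ∪ (Finset.range (m + 1)).image e * (F * C) ∪ H ∪
    C.biUnion fun c => B (r c) * (F * C) with hT
  obtain ⟨F', hTF, hF'⟩ := Infinite.exists_superset_card_eq T (T.card + 2 * (F.card * C.card))
    (Nat.le_add_right _ _)
  refine ⟨C, H, F', r, by omega, by omega, hr, hmeet, hsep, ?_, ?_, ?_, ?_, by omega⟩
  · intro f hf c hc
    refine hTF ?_
    simp only [hT, Finset.mem_union]
    exact Or.inl (Or.inl (Or.inl (Finset.mul_mem_mul hf hc)))
  · intro i hi f hf c hc
    refine hTF ?_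
    simp only [hT, Finset.mem_union]
    exact Or.inl (Or.inl (Or.inr (Finset.mul_mem_mul
      (Finset.mem_image_of_mem _ (Finset.mem_range.2 (Nat.lt_succ_of_le hi)))
      (Finset.mul_mem_mul hf hc))))
  · refine fun x hx => hTF ?_
    simp only [hT, Finset.mem_union]
    exact Or.inl (Or.inr hx)
  · intro c hc f hf b hb
    refine hTF ?_
    simp only [hT, Finset.mem_union]
    exact Or.inr (Finset.mem_biUnion.2 ⟨c, hc, Finset.mul_mem_mul hb (Finset.mul_mem_mul hf hc)⟩)

theorem HasSpreadCenters.exists_system [Countable G] {B : ℕ → Finset G}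
    (hB : HasSpreadCenters B) (h1 : ∀ i, 1 ∈ B i) :
    ∃ (S : RankOneSystem G) (H : ℕ → Finset G) (r : ℕ → G → ℕ), ∀ m,
      (H m).card * 2 ^ (m + 2) ≤ (S.C m).card ∧ H m ⊆ S.F (m + 1) ∧
      ∀ c ∈ S.C m, m ≤ r m c ∧ ∀ f ∈ S.F m, (∃ b ∈ B (r m c), b * (f * c) ∈ H m) ∧
        ∀ b ∈ B (r m c), b * (f * c) ∈ S.F (m + 1) ∧
          ∀ c' ∈ S.C m, ∀ f' ∈ S.F m, b * (f * c) = f' * c' → c = c' := by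
  have := hB.infinite
  obtain ⟨e, he⟩ := exists_surjective_nat G
  choose C H F' r h2 hcard hr hmeet hsep hmul habs hHF hBF hgrow using hB.exists_next e
  let F : ℕ → Finset G := fun m => Nat.rec {1} F' m
  refine ⟨{ F := F
            C := fun m => C m (F m)
            F_zero := rfl
            two_le := fun m => h2 m _
            inj := fun m f hf f' hf' c hc c' hc' heq =>
              hsep m _ c hc f hf 1 (h1 _) c' hc' f' hf' (by rwa [one_mul])
            mul_mem := fun m => hmul m _
            absorb := fun g => ?_
            growth := fun m => hgrow m _ }, fun m => H m (F m), fun m => r m (F m), fun m =>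
    ⟨hcard m _, hHF m _, fun c hc => ⟨hr m _ c hc, fun f hf => ⟨hmeet m _ c hc f hf, fun b hb =>
      ⟨hBF m _ c hc f hf b hb, hsep m _ c hc f hf b hb⟩⟩⟩⟩⟩
  obtain ⟨i, rfl⟩ := he g
  exact (eventually_ge_atTop i).mono fun m hm => habs m _ i hm

end Construction

/-! ### Failure of the ratio ergodic theorem -/

section Ratio

variable {G : Type*} [Group G]

namespace RankOneSystem

variable (S : RankOneSystem G) (H : ℕ → Finset G)

theorem one_mem_F_zero : (1 : G) ∈ S.F 0 := by simp [S.F_zero]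

/-- The translates `b * (d * c)` of a point of the copy of the tower of stage `m` at position `c`
that lie over the base level are at most as many as the positions over the base level in a single
copy, provided that no translate enters another copy. -/
theorem card_orbit_le {m : ℕ} {T : Finset G} {d c : G}
    (hT : ∀ b ∈ T, ∀ c' ∈ S.C m, ∀ f' ∈ S.F m, b * (d * c) = f' * c' → c = c')
    (hT' : ∀ b ∈ T, b * (d * c) ∈ S.branch 1 0 (m + 1)) : T.card ≤ (S.branch 1 0 m).card := by
  refine Finset.card_le_card_of_injOn (fun b => b * d) (fun b hb => ?_) (by simp)
  obtain ⟨e, he, c', hc', heq⟩ := (S.mem_branch_succ (Nat.zero_le m)).1 (hT' b hb)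
  have := hT b hb c' hc' e (S.branch_subset S.one_mem_F_zero (Nat.zero_le m) he) heq.symm
  subst this
  have : b * d = e := mul_right_cancel (by rw [mul_assoc, heq])
  simpa [this] using he

variable [Countable G]

/-- The numerator of the counterexample. At stage `m` it puts the mass `|C 0| ⋯ |C (m - 1)|`, which
is the sum of the indicator of the base level over one copy of the tower of stage `m`, on each of
the levels `H m` of the tower of stage `m + 1`. -/
noncomputable def heavy (x : TailSpace G) : ℝ≥0∞ :=
  ∑' m, ((S.branch 1 0 m).card : ℝ≥0∞) *
    ∑ h ∈ H m, (S.level h (m + 1)).indicator (fun _ => 1) x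

theorem card_branch_le_heavy {m : ℕ} {h : G} (hh : h ∈ H m) {x : TailSpace G}
    (hx : x ∈ S.level h (m + 1)) : ((S.branch 1 0 m).card : ℝ≥0∞) ≤ S.heavy H x := by
  refine le_trans ?_ (ENNReal.le_tsum m)
  refine le_mul_of_one_le_right' ?_
  calc (1 : ℝ≥0∞) = (S.level h (m + 1)).indicator (fun _ => 1) x := by simp [hx]
    _ ≤ _ := Finset.single_le_sum
      (f := fun h => (S.level h (m + 1)).indicator (fun _ => (1 : ℝ≥0∞)) x)
      (fun _ _ => zero_le) hh

variable [MeasurableSpace G] [DiscreteMeasurableSpace G]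

theorem measurable_heavy : Measurable (S.heavy H) := by
  refine Measurable.tsum fun m => Measurable.const_mul ?_ _
  exact Finset.measurable_fun_sum _ fun h _ =>
    measurable_const.indicator (S.measurableSet_level h _)

/-- The integral of the numerator is at most `∑ |H m| / |C m| ≤ ∑ 2 ^ (-(m + 2)) = 1 / 2`, since
`|C 0| ⋯ |C (m - 1)|` times the measure of a level of stage `m + 1` is `1 / |C m|`. -/
theorem lintegral_heavy_le (hH : ∀ m, H m ⊆ S.F (m + 1))
    (hcard : ∀ m, (H m).card * 2 ^ (m + 2) ≤ (S.C m).card) :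
    ∫⁻ x, S.heavy H x ∂S.measure ≤ 2⁻¹ := by
  have hmeas : ∀ m, ∀ h ∈ H m,
      Measurable ((S.level h (m + 1)).indicator (fun _ : TailSpace G => (1 : ℝ≥0∞))) :=
    fun m h _ => measurable_const.indicator (S.measurableSet_level h _)
  calc ∫⁻ x, S.heavy H x ∂S.measure
      = ∑' m, ((S.branch 1 0 m).card : ℝ≥0∞) * ((H m).card * S.weight (m + 1)) := by
        unfold heavy
        rw [lintegral_tsum fun m =>
          ((Finset.measurable_fun_sum _ (hmeas m)).const_mul _).aemeasurable]
        congr 1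
        ext m
        rw [lintegral_const_mul _ (Finset.measurable_fun_sum _ (hmeas m)),
          lintegral_finsetSum _ (hmeas m)]
        congr 1
        rw [Finset.sum_congr rfl fun h hh => by
          rw [lintegral_indicator_const (S.measurableSet_level h _), one_mul,
            S.measure_level (hH m hh)]]
        simp
    _ ≤ ∑' m : ℕ, 2⁻¹ ^ (m + 2) := by
        refine ENNReal.tsum_le_tsum fun m => ?_
        have h1 := S.weight_mul_card_branch S.one_mem_F_zero (Nat.zero_le m)
        rw [weight_zero] at h1
        calc ((S.branch 1 0 m).card : ℝ≥0∞) * ((H m).card * S.weight (m + 1))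
            = (S.weight m * (S.branch 1 0 m).card) * ((H m).card * ((S.C m).card : ℝ≥0∞)⁻¹) := by
              rw [weight_succ]; ring
          _ = (H m).card / (S.C m).card := by rw [h1, one_mul, div_eq_mul_inv]
          _ ≤ 2⁻¹ ^ (m + 2) := by
              refine ENNReal.div_le_of_le_mul ?_
              rw [← ENNReal.inv_pow, mul_comm, ← div_eq_mul_inv,
                ENNReal.le_div_iff_mul_le (by simp) (by simp)]
              exact_mod_cast hcard m
    _ = 2⁻¹ := by
        simp only [pow_add]
        rw [ENNReal.tsum_mul_right, ENNReal.tsum_geometric, ENNReal.one_sub_inv_two, inv_inv,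
          pow_two, ← mul_assoc, ENNReal.mul_inv_cancel (by simp) (by simp), one_mul]

end RankOneSystem

/-- The ratios of the numerator `heavy` to the indicator of the base level are at least `1` at
infinitely many times from almost every point of the base level, although the ratio of the integrals
is at most `1 / 2`. -/
theorem HasSpreadCenters.not_ratioErgodicTheorem [Countable G] {B : ℕ → Finset G}
    (hB : HasSpreadCenters B) (h1 : ∀ i, 1 ∈ B i) : ¬ RatioErgodicTheorem G B := by
  intro hRET
  let _ : MeasurableSpace G := ⊤
  have : DiscreteMeasurableSpace G := ⟨fun _ => trivial⟩
  obtain ⟨S, H, r, hS⟩ := hB.exists_system h1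
  have hlint := S.lintegral_heavy_le H (fun m => (hS m).2.1) (fun m => (hS m).1)
  have hlint' : ∫⁻ x, S.heavy H x ∂S.measure ≠ ∞ := ne_top_of_le_ne_top (by simp) hlint
  have hfin : ∀ᵐ x ∂S.measure, S.heavy H x < ∞ := ae_lt_top (S.measurable_heavy H) hlint'
  set φ : TailSpace G → ℝ := fun x => (S.heavy H x).toReal with hφ
  set ψ : TailSpace G → ℝ := (S.level 1 0).indicator fun _ => 1 with hψ
  have hφi : Integrable φ S.measure :=
    integrable_toReal_of_lintegral_ne_top (S.measurable_heavy H).aemeasurable hlint'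
  have hφint : ∫ x, φ x ∂S.measure ≤ 2⁻¹ := by
    rw [hφ, integral_toReal (S.measurable_heavy H).aemeasurable hfin]
    simpa using ENNReal.toReal_mono (by simp) hlint
  have hlev : S.measure (S.level 1 0) = 1 := by
    rw [S.measure_level S.one_mem_F_zero, S.weight_zero]
  have hψi : Integrable ψ S.measure :=
    (integrable_indicator_iff (S.measurableSet_level 1 0)).2
      (integrableOn_const (by rw [hlev]; simp))
  have hψint : ∫ x, ψ x ∂S.measure = 1 := by
    rw [hψ, integral_indicator_const _ (S.measurableSet_level 1 0)]
    simp [Measure.real, hlev]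
  have hae := hRET (TailSpace G) S.measure inferInstance S.isNonatomic S.measure_univ φ ψ hφi hψi
    (by simp [hψint])
  have hfin' : ∀ᵐ x ∂S.measure, ∀ g : G, S.heavy H (g • x) < ∞ :=
    ae_all_iff.2 fun g => (measurePreserving_smul g S.measure).quasiMeasurePreserving.ae hfin
  -- almost every sequence of steps gives a point at which both properties hold
  have hle : S.law 1 0 ≤ S.measure := by
    have : S.approx 0 = S.law 1 0 := by
      simp [RankOneSystem.approx, S.F_zero, S.weight_zero]
    exact this ▸ S.approx_le_measure 0
  have hω := ae_of_ae_map (measurable_walkEnd 1 0).aemeasurable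
    ((Measure.absolutelyContinuous_of_le hle).ae_le (hae.and hfin'))
  obtain ⟨ω, ⟨hlim, hfinω⟩, hωC⟩ := (hω.and S.ae_mem).exists
  rw [hψint, div_one] at hlim
  -- A stage `m` after which, if the limit were right, all ratios would be less than `1`.
  obtain ⟨m, hm⟩ := eventually_atTop.1
    (hlim.eventually_lt_const (u := 1) (hφint.trans_lt (by norm_num)))
  obtain ⟨hr, hc⟩ := (hS m).2.2 (ω m) (hωC m)
  set d := walk 1 0 ω m with hd
  have hdD : d ∈ S.branch 1 0 m :=
    S.walk_mem_branch le_rfl (by simp [S.branch_of_le 1 le_rfl]) hωC (Nat.zero_le m)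
  have hdF : d ∈ S.F m := S.branch_subset S.one_mem_F_zero (Nat.zero_le m) hdD
  obtain ⟨⟨b₀, hb₀, hb₀H⟩, hsep⟩ := hc d hdF
  have hpt : ∀ b : G, b • walkEnd 1 0 ω = walkEnd (b * (d * ω m)) (m + 1) ω := by
    intro b
    rw [walkEnd_eq 1 (Nat.zero_le (m + 1)) ω, walk_succ _ _ (Nat.zero_le m), smul_walkEnd]
  have hψb : ∀ b ∈ B (r m (ω m)), b • walkEnd 1 0 ω ∈ S.level 1 0 ↔
      b * (d * ω m) ∈ S.branch 1 0 (m + 1) := by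
    intro b hb
    rw [hpt]
    exact S.walkEnd_mem_level S.one_mem_F_zero (Nat.zero_le _) (hsep b hb).1 hωC
  set D : ℝ := ((S.branch 1 0 m).card : ℝ) with hD
  -- The orbit segment reaches `H m`,
  have hnum : D ≤ orbitSum (B (r m (ω m))) φ (walkEnd 1 0 ω) := by
    have hmem : b₀ • walkEnd 1 0 ω ∈ S.level (b₀ * (d * ω m)) (m + 1) := by
      rw [hpt, S.walkEnd_mem_level (hsep b₀ hb₀).1 le_rfl (hsep b₀ hb₀).1 hωC,
        S.branch_of_le _ le_rfl]
      exact Finset.mem_singleton_self _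
    calc D = ((S.branch 1 0 m).card : ℝ≥0∞).toReal := by simp [hD]
      _ ≤ φ (b₀ • walkEnd 1 0 ω) :=
          ENNReal.toReal_mono (hfinω b₀).ne (S.card_branch_le_heavy H hb₀H hmem)
      _ ≤ _ := Finset.single_le_sum (f := fun b => φ (b • walkEnd 1 0 ω))
          (fun _ _ => ENNReal.toReal_nonneg) hb₀
  classical
  have hden : orbitSum (B (r m (ω m))) ψ (walkEnd 1 0 ω) =
      (((B (r m (ω m))).filter fun b => b * (d * ω m) ∈ S.branch 1 0 (m + 1)).card : ℝ) := by
    rw [orbitSum, Finset.card_filter, Nat.cast_sum]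
    refine Finset.sum_congr rfl fun b hb => ?_
    simp only [hψ, Set.indicator_apply, hψb b hb]
    push_cast
    rfl
  -- but it sees no copy of the tower of stage `m` other than the one it starts in.
  have hden_le : orbitSum (B (r m (ω m))) ψ (walkEnd 1 0 ω) ≤ D := by
    rw [hden, hD]
    exact_mod_cast S.card_orbit_le
      (fun b hb => (hsep b (Finset.mem_filter.1 hb).1).2) (fun b hb => (Finset.mem_filter.1 hb).2)
  have hden_pos : 0 < orbitSum (B (r m (ω m))) ψ (walkEnd 1 0 ω) := by
    rw [hden]
    refine Nat.cast_pos.2 (Finset.card_pos.2 ⟨1, Finset.mem_filter.2 ⟨h1 _, ?_⟩⟩)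
    rw [one_mul, S.mem_branch_succ (Nat.zero_le m)]
    exact ⟨d, hdD, ω m, hωC m, rfl⟩
  have hlt := hm _ hr
  rw [orbitRatio, div_lt_one hden_pos] at hlt
  linarith

end Ratio

/-! ### Balls of the word length -/

section Balls

variable {G : Type*} [Group G] (A : Finset G)

theorem one_mem_wordBall (n : ℕ) : 1 ∈ wordBall A n := by
  classical
  exact Finset.one_mem_pow (Finset.mem_insert_self _ _)

theorem wordBall_mono : Monotone (wordBall A) := by
  classical
  exact fun _ _ h => Finset.pow_subset_pow_right (Finset.mem_insert_self _ _) h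

variable {A}

theorem mul_mem_wordBall {m n : ℕ} {g h : G} (hg : g ∈ wordBall A m) (hh : h ∈ wordBall A n) :
    g * h ∈ wordBall A (m + n) := by
  classical
  unfold wordBall at *
  rw [pow_add]
  exact Finset.mul_mem_mul hg hh

theorem exists_mul_of_mem_wordBall_add {m n : ℕ} {g : G} (hg : g ∈ wordBall A (m + n)) :
    ∃ p ∈ wordBall A m, ∃ q ∈ wordBall A n, p * q = g := by
  classical
  unfold wordBall at *
  rw [pow_add] at hg
  exact Finset.mem_mul.1 hg

theorem inv_mem_wordBall {n : ℕ} {g : G} (hg : g ∈ wordBall A n) : g⁻¹ ∈ wordBall A n := by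
  classical
  have : (wordBall A n)⁻¹ = wordBall A n := by
    unfold wordBall
    rw [← inv_pow]
    congr 1
    ext x
    simp only [Finset.mem_inv', Finset.mem_insert, Finset.mem_union, inv_eq_one, inv_inv]
    tauto
  rw [← this]
  exact Finset.inv_mem_inv hg

theorem exists_mem_wordBall (hA : Subgroup.closure (A : Set G) = ⊤) (g : G) :
    ∃ n, g ∈ wordBall A n := by
  classical
  have hg : g ∈ Subgroup.closure (A : Set G) := hA ▸ Subgroup.mem_top g
  induction hg using Subgroup.closure_induction with
  | mem x hx =>
    refine ⟨1, ?_⟩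
    unfold wordBall
    simp only [pow_one, Finset.mem_insert, Finset.mem_union]
    exact Or.inr (Or.inl hx)
  | one => exact ⟨0, one_mem_wordBall A 0⟩
  | mul x y _ _ hx hy =>
    obtain ⟨m, hm⟩ := hx
    obtain ⟨n, hn⟩ := hy
    exact ⟨m + n, mul_mem_wordBall hm hn⟩
  | inv x _ hx =>
    obtain ⟨n, hn⟩ := hx
    exact ⟨n, inv_mem_wordBall hn⟩

theorem exists_subset_wordBall (hA : Subgroup.closure (A : Set G) = ⊤) (D : Finset G) :
    ∃ n, D ⊆ wordBall A n := by
  choose k hk using exists_mem_wordBall hA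
  exact ⟨D.sup k, fun g hg => wordBall_mono A (Finset.le_sup hg) (hk g)⟩

theorem countable_of_closure_eq_top (hA : Subgroup.closure (A : Set G) = ⊤) : Countable G := by
  refine Set.countable_univ_iff.1 ((Set.countable_iUnion fun n =>
    (wordBall A n).countable_toSet).mono fun g _ => ?_)
  obtain ⟨n, hn⟩ := exists_mem_wordBall hA g
  exact Set.mem_iUnion.2 ⟨n, hn⟩

/-- Greedy selection of balls in the order of decreasing radii: a family of balls has a subfamily
that covers the centers of the family and whose members contain no center of another member. -/
theorem exists_separated_cover (ρ : G → ℕ) (T : Finset G) :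
    ∃ T' ⊆ T, (∀ h ∈ T, ∃ g ∈ T', h * g⁻¹ ∈ wordBall A (ρ g)) ∧
      ∀ g ∈ T', ∀ g' ∈ T', g * g'⁻¹ ∈ wordBall A (ρ g) → g = g' := by
  classical
  induction T using Finset.strongInduction with
  | H T ih =>
    rcases T.eq_empty_or_nonempty with rfl | hT
    · exact ⟨∅, by simp⟩
    obtain ⟨g₀, hg₀, hmax⟩ := T.exists_max_image ρ hT
    have hself : g₀ * g₀⁻¹ ∈ wordBall A (ρ g₀) := by
      rw [mul_inv_cancel]; exact one_mem_wordBall A _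
    obtain ⟨T₁, hT₁, hcov, hsep⟩ := ih (T.filter fun h => h * g₀⁻¹ ∉ wordBall A (ρ g₀))
      (Finset.filter_ssubset.2 ⟨g₀, hg₀, not_not.2 hself⟩)
    have hfar : ∀ h ∈ T₁, h ∈ T ∧ h * g₀⁻¹ ∉ wordBall A (ρ g₀) := fun h hh =>
      Finset.mem_filter.1 (hT₁ hh)
    refine ⟨insert g₀ T₁, Finset.insert_subset hg₀ fun h hh => (hfar h hh).1, fun h hh => ?_, ?_⟩
    · by_cases hh' : h * g₀⁻¹ ∈ wordBall A (ρ g₀)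
      · exact ⟨g₀, Finset.mem_insert_self _ _, hh'⟩
      · obtain ⟨g, hg, hgh⟩ := hcov h (Finset.mem_filter.2 ⟨hh, hh'⟩)
        exact ⟨g, Finset.mem_insert_of_mem hg, hgh⟩
    · intro g hg g' hg' hgg'
      rcases Finset.mem_insert.1 hg with h₁ | h₁ <;>
        rcases Finset.mem_insert.1 hg' with h₂ | h₂
      · rw [h₁, h₂]
      · refine absurd ?_ (hfar g' h₂).2
        subst h₁
        simpa using inv_mem_wordBall hgg'
      · subst h₂
        exact absurd (wordBall_mono A (hmax g (hfar g h₁).1) hgg') (hfar g h₁).2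
      · exact hsep g h₁ g' h₂ hgg'

/-- A greedily chosen subfamily of large multiplicity at a point `h` provides many separated centers
that are within their radii of `h`. Moving `h` to the identity gives the set `C`. The enlargement
of the radii by `2 k`, where `D` lies in the ball of radius `k`, makes room for replacing the
centers by copies of `D`. -/
theorem hasSpreadCenters_wordBall (hA : Subgroup.closure (A : Set G) = ⊤)
    (hB : ∀ m : ℕ → ℕ, StrictMono m → ¬ IsBesicovitch (fun i => wordBall A (m i)))
    {n : ℕ → ℕ} (hn : StrictMono n) : HasSpreadCenters fun i => wordBall A (n i) := by
  classical
  intro D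
  obtain ⟨k, hk⟩ := exists_subset_wordBall hA D
  refine ⟨wordBall A (k + (k + k)), fun N i₀ => ?_⟩
  have hmono : StrictMono fun i => n (i + i₀) + (k + k) := fun i j hij => by
    have := hn (Nat.add_lt_add_right hij i₀)
    simp only
    omega
  have hnot := hB _ hmono
  simp only [IsBesicovitch, not_exists, not_forall] at hnot
  obtain ⟨T, ρ, hT⟩ := hnot N
  obtain ⟨T', hT', hcov, hsep⟩ := exists_separated_cover (A := A)
    (fun g => n (ρ g + i₀) + (k + k)) T
  have hmult : ∃ h, N < (T'.filter fun g =>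
      h * g⁻¹ ∈ wordBall A (n (ρ g + i₀) + (k + k))).card := by
    by_contra! hle
    exact hT T' ⟨hT', hcov, fun h => by convert hle h⟩
  obtain ⟨h, hh⟩ := hmult
  set T₁ := T'.filter fun g => h * g⁻¹ ∈ wordBall A (n (ρ g + i₀) + (k + k)) with hT₁
  refine ⟨T₁.image fun g => g * h⁻¹, fun c => ρ (c * h) + i₀, ?_, fun c _ => Nat.le_add_left _ _,
    ?_, ?_⟩
  · rw [Finset.card_image_of_injective _ (mul_left_injective h⁻¹)]
    exact hh.le
  · intro c hc f hf
    obtain ⟨g, hg, rfl⟩ := Finset.mem_image.1 hc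
    have hg' := inv_mem_wordBall (Finset.mem_filter.1 hg).2
    have hfg : f * (g * h⁻¹) ∈ wordBall A (n (ρ g + i₀) + (k + (k + k))) := by
      have := mul_mem_wordBall (hk hf) hg'
      rw [mul_inv_rev, inv_inv] at this
      rwa [show n (ρ g + i₀) + (k + (k + k)) = k + (n (ρ g + i₀) + (k + k)) by omega]
    -- The ball of radius `n (ρ g + i₀)` need not reach the identity from `f * (g * h⁻¹)`, but an
    -- initial part of that length of a word for this element leads it into `wordBall A (3 k)`.
    obtain ⟨p, hp, q, hq, hpq⟩ := exists_mul_of_mem_wordBall_add hfg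
    refine ⟨p⁻¹, ?_, ?_⟩
    · simpa using inv_mem_wordBall hp
    · rw [← hpq]
      simpa using hq
  · intro c hc f hf b hb c' hc' f' hf' heq
    obtain ⟨g, hg, rfl⟩ := Finset.mem_image.1 hc
    obtain ⟨g', hg', rfl⟩ := Finset.mem_image.1 hc'
    simp only [inv_mul_cancel_right] at hb
    have hgg' : g * g'⁻¹ = f⁻¹ * (b⁻¹ * f') := by
      have : g * h⁻¹ = f⁻¹ * (b⁻¹ * (f' * (g' * h⁻¹))) := by rw [← heq]; group
      calc g * g'⁻¹ = (g * h⁻¹) * (h * g'⁻¹) := by group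
        _ = _ := by rw [this]; group
    rw [hsep g (Finset.mem_filter.1 hg).1 g' (Finset.mem_filter.1 hg').1 ?_]
    rw [hgg']
    have := mul_mem_wordBall (inv_mem_wordBall (hk hf))
      (mul_mem_wordBall (inv_mem_wordBall hb) (hk hf'))
    rwa [show n (ρ g + i₀) + (k + k) = k + (n (ρ g + i₀) + k) by omega]

end Balls

end RatioErgodic

theorem theorem1p3 {G : Type*} [Group G] (A : Finset G)
    (hA : Subgroup.closure (A : Set G) = ⊤)
    (hB : ∀ m : ℕ → ℕ, StrictMono m →
      ¬ RatioErgodic.IsBesicovitch (fun i => RatioErgodic.wordBall A (m i)))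
    (n : ℕ → ℕ) (hn : StrictMono n) :
    ¬ RatioErgodic.RatioErgodicTheorem G (fun i => RatioErgodic.wordBall A (n i)) := by
  have := RatioErgodic.countable_of_closure_eq_top hA
  exact (RatioErgodic.hasSpreadCenters_wordBall hA hB hn).not_ratioErgodicTheorem
    fun i => RatioErgodic.one_mem_wordBall A (n i)
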